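/- Let $0<q<1$. For a complex function $f$ put $$(Df)(x)=\frac{f(q^{-1}x)-f(qx)}{q^{-1}x-qx},$$ and let $H$ be the Hilbert space of complex functions $f$ on $q^{-2\mathbb Z_+}=\{1,q^{-2},q^{-4},\dots\}$ with $$\|f\|^2=\int_1^\infty|f(x)|^2\,d_{q^{-2}}x=(1-q^2)\sum_{n=0}^\infty|f(q^{-2n})|^2q^{-2n}<\infty .$$ Let $\Box^{(0)}:H\to H$ be the bounded linear operator (the radial part of the Laplace-Beltrami operator of the quantum disc) $$\Box^{(0)}f=D\,x(q^{-1}x-1)\,Df,$$ where $x(q^{-1}x-1)$ denotes multiplication by that function; at $x=1$ the expression does not involve the value $f(q^2)$, since that value enters with the coefficient $x-1=0$. Then the spectrum of $\Box^{(0)}$ is exactly the segment $$\left[-\frac1{(1-q)^2},\,-\frac1{(1+q)^2}\right],$$ $\Box^{(0)}$ has no eigenvalues (its discrete spectrum is empty), and, in the sense of the order on bounded self-adjoint operators, $$\frac1{(1+q)^2}\le-\Box^{(0)}\le\frac1{(1-q)^2}.$$ -/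

import Mathlib

open MeasureTheory

noncomputable section

/-- The symmetric `q`-difference operator
`(D f)(x) = (f (q⁻¹ x) - f (q x)) / (q⁻¹ x - q x)`. -/
def qDiff (q : ℝ) (f : ℝ → ℂ) (x : ℝ) : ℂ :=
  (f (q⁻¹ * x) - f (q * x)) / ((q⁻¹ * x - q * x : ℝ) : ℂ)

/-- The difference expression `f ↦ D x (q⁻¹ x - 1) D f`: the composition of `D`, multiplication by
the function `x (q⁻¹ x - 1)`, and `D`. -/
def radialBox (q : ℝ) (f : ℝ → ℂ) : ℝ → ℂ :=
  qDiff q (fun y => ((y * (q⁻¹ * y - 1) : ℝ) : ℂ) * qDiff q f y)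

/-- The point `q⁻²ⁿ` of the geometric progression. -/
def gridPoint (q : ℝ) (n : ℕ) : ℝ := (q ^ 2)⁻¹ ^ n

/-- The Jackson measure on `{1, q⁻², q⁻⁴, …}`, so that
`∫ f = (1 - q²) ∑ₙ f(q⁻²ⁿ) q⁻²ⁿ`. -/
def jacksonMeasure (q : ℝ) : Measure ℝ :=
  Measure.sum fun n : ℕ =>
    ENNReal.ofReal ((1 - q ^ 2) * gridPoint q n) • Measure.dirac (gridPoint q n)

/-- The Hilbert space of complex functions on `{1, q⁻², q⁻⁴, …}` that are square integrable with
respect to the Jackson measure. -/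
abbrev RadialL2 (q : ℝ) : Type := Lp ℂ 2 (jacksonMeasure q)

lemma gridPoint_pos {q : ℝ} (hq0 : 0 < q) (n : ℕ) : 0 < gridPoint q n := by
  unfold gridPoint; positivity

lemma gridPoint_succ {q : ℝ} (hq0 : 0 < q) (n : ℕ) :
    q ^ 2 * gridPoint q (n + 1) = gridPoint q n := by
  have h : q ^ 2 ≠ 0 := by positivity
  unfold gridPoint
  rw [pow_succ' _ n, ← mul_assoc, mul_inv_cancel₀ h, one_mul]

lemma ae_jacksonMeasure {q : ℝ} (hq0 : 0 < q) (hq1 : q < 1) (P : ℝ → Prop) :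
    (∀ᵐ x ∂(jacksonMeasure q), P x) ↔ ∀ n, P (gridPoint q n) := by
  unfold jacksonMeasure
  rw [Measure.ae_sum_iff]
  refine forall_congr' fun n => ?_
  rw [Measure.ae_ennreal_smul_measure_iff, ae_dirac_eq]
  · exact Filter.eventually_pure
  · have h1 : 0 < 1 - q ^ 2 := by nlinarith
    have := gridPoint_pos hq0 n
    simp only [ne_eq, ENNReal.ofReal_eq_zero, not_le]
    positivity

lemma aestronglyMeasurable_jacksonMeasure (q : ℝ) (f : ℝ → ℂ) :
    AEStronglyMeasurable f (jacksonMeasure q) := by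
  unfold jacksonMeasure
  rw [aestronglyMeasurable_sum_measure_iff]
  intro n
  exact (aestronglyMeasurable_dirac).smul_measure _

lemma lintegral_jacksonMeasure (q : ℝ) (g : ℝ → ENNReal) :
    ∫⁻ x, g x ∂(jacksonMeasure q)
      = ∑' n, ENNReal.ofReal ((1 - q ^ 2) * gridPoint q n) * g (gridPoint q n) := by
  unfold jacksonMeasure
  rw [lintegral_sum_measure]
  simp

lemma eLpNorm_two_sq_jacksonMeasure (q : ℝ) (f : ℝ → ℂ) :
    eLpNorm f 2 (jacksonMeasure q) ^ 2
      = ∑' n, ENNReal.ofReal ((1 - q ^ 2) * gridPoint q n * ‖f (gridPoint q n)‖ ^ 2) := by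
  have h := eLpNorm_nnreal_pow_eq_lintegral (f := f) (μ := jacksonMeasure q)
    (p := (2 : NNReal)) (by norm_num)
  have h2 : ((2 : NNReal) : ℝ) = ((2 : ℕ) : ℝ) := by norm_num
  simp only [h2, ENNReal.rpow_natCast] at h
  rw [show (2 : ENNReal) = ((2 : NNReal) : ENNReal) by norm_num, h, lintegral_jacksonMeasure]
  refine tsum_congr fun n => ?_
  rw [ENNReal.ofReal_mul' (sq_nonneg ‖f (gridPoint q n)‖), ENNReal.ofReal_pow (norm_nonneg _), ofReal_norm]

/-- At the grid points the difference expression is a three-term one; at the first grid point it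
does not involve a value outside the grid. -/
lemma radialBox_gridPoint {q : ℝ} (hq0 : 0 < q) (hq1 : q < 1) (f : ℝ → ℂ) (n : ℕ) :
    radialBox q f (gridPoint q n)
      = (((1 - q ^ (2 * (n + 1))) / (1 - q ^ 2) ^ 2 : ℝ) : ℂ)
          * (f (gridPoint q (n + 1)) - f (gridPoint q n))
        - ((q ^ 2 * (1 - q ^ (2 * n)) / (1 - q ^ 2) ^ 2 : ℝ) : ℂ)
          * (f (gridPoint q n) - f (gridPoint q (n - 1))) := by
  have hq : q ≠ 0 := hq0.ne'
  have h1 : 1 - q ^ 2 ≠ 0 := by nlinarith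
  have hx : gridPoint q n ≠ 0 := (gridPoint_pos hq0 n).ne'
  have e1 : q⁻¹ * (q⁻¹ * gridPoint q n) = gridPoint q (n + 1) := by
    rw [← gridPoint_succ hq0 n]; field_simp
  have e2 : q * (q⁻¹ * gridPoint q n) = gridPoint q n := by field_simp
  have e3 : q⁻¹ * (q * gridPoint q n) = gridPoint q n := by field_simp
  have e5 : q ^ (2 * n) * gridPoint q n = 1 := by
    unfold gridPoint; rw [pow_mul, ← mul_pow, mul_inv_cancel₀ (by positivity), one_pow]
  have e6 : q ^ (2 * n) = (gridPoint q n)⁻¹ := eq_inv_of_mul_eq_one_left e5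
  have e7 : q ^ (2 * (n + 1)) = q ^ 2 * (gridPoint q n)⁻¹ := by
    rw [← e6]; ring
  have e4 : (gridPoint q n - 1 : ℝ) = 0 ∨ q * (q * gridPoint q n) = gridPoint q (n - 1) := by
    cases n with
    | zero => left; simp [gridPoint]
    | succ m => right; rw [Nat.add_sub_cancel, ← gridPoint_succ hq0 m]; ring
  have hc1 : (1 - (q : ℂ) ^ 2) ≠ 0 := by exact_mod_cast h1
  have hc2 : (q : ℂ) ≠ 0 := by exact_mod_cast hq
  have hc3 : ((gridPoint q n : ℝ) : ℂ) ≠ 0 := by exact_mod_cast hx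
  simp only [radialBox, qDiff, e1, e2, e3, e6, e7]
  set x := gridPoint q n with hxdef
  have d1 : ((q⁻¹ * x - q * x : ℝ) : ℂ) = (1 - (q : ℂ) ^ 2) * x / q := by
    push_cast; field_simp
  have e8 : gridPoint q (n + 1) = x / q ^ 2 := by
    rw [← e1]; field_simp
  have d2 : ((gridPoint q (n + 1) - x : ℝ) : ℂ) = (1 - (q : ℂ) ^ 2) * x / q ^ 2 := by
    rw [e8]; push_cast; field_simp
  have d3 : ((x - q * (q * x) : ℝ) : ℂ) = (1 - (q : ℂ) ^ 2) * x := by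
    push_cast; ring
  rw [d1, d2, d3]
  generalize f (gridPoint q (n + 1)) = A
  rw [e8]
  rcases e4 with h0 | h0
  · have hx1 : x = 1 := by linarith
    rw [hx1]
    push_cast
    field_simp
    simp
  · rw [h0]
    push_cast
    field_simp

lemma radialBox_norm_sq_le {q : ℝ} (hq0 : 0 < q) (hq1 : q < 1) (f : ℝ → ℂ) (n : ℕ) :
    (1 - q ^ 2) * gridPoint q n * ‖radialBox q f (gridPoint q n)‖ ^ 2
      ≤ 8 / (q ^ 2 * (1 - q ^ 2) ^ 4) *
        ((1 - q ^ 2) * gridPoint q (n + 1) * ‖f (gridPoint q (n + 1))‖ ^ 2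
          + (1 - q ^ 2) * gridPoint q n * ‖f (gridPoint q n)‖ ^ 2
          + (1 - q ^ 2) * gridPoint q (n - 1) * ‖f (gridPoint q (n - 1))‖ ^ 2) := by
  have h1 : 0 < 1 - q ^ 2 := by nlinarith
  have hx := gridPoint_pos hq0 n
  have hx' := gridPoint_pos hq0 (n + 1)
  have hx'' := gridPoint_pos hq0 (n - 1)
  have hw1 : gridPoint q n ≤ gridPoint q (n + 1) := by
    rw [← gridPoint_succ hq0 n]; nlinarith
  have hw2 : q ^ 2 * gridPoint q n ≤ gridPoint q (n - 1) := by
    cases n with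
    | zero => simp [gridPoint, abs_of_pos hq0, hq1.le]
    | succ m => rw [Nat.add_sub_cancel, gridPoint_succ hq0 m]
  set K : ℝ := 1 / (1 - q ^ 2) ^ 2 with hK
  have hKpos : 0 < K := by positivity
  have hp : ∀ m : ℕ, 0 ≤ q ^ m ∧ q ^ m ≤ 1 := fun m =>
    ⟨by positivity, pow_le_one₀ hq0.le hq1.le⟩
  have ha : ‖(((1 - q ^ (2 * (n + 1))) / (1 - q ^ 2) ^ 2 : ℝ) : ℂ)‖ ≤ K := by
    rw [Complex.norm_real, Real.norm_of_nonneg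
      (div_nonneg (by linarith [(hp (2 * (n + 1))).2]) (by positivity)), hK]
    gcongr
    linarith [(hp (2 * (n + 1))).1]
  have hc : ‖((q ^ 2 * (1 - q ^ (2 * n)) / (1 - q ^ 2) ^ 2 : ℝ) : ℂ)‖ ≤ K := by
    rw [Complex.norm_real, Real.norm_of_nonneg
      (div_nonneg (mul_nonneg (by positivity) (by linarith [(hp (2 * n)).2])) (by positivity)), hK]
    gcongr
    nlinarith [(hp (2 * n)).1, (hp (2 * n)).2, (hp 2).1, (hp 2).2]
  set A := f (gridPoint q (n + 1))
  set B := f (gridPoint q n)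
  set C := f (gridPoint q (n - 1))
  have hB : ‖radialBox q f (gridPoint q n)‖ ≤ K * (‖A‖ + 2 * ‖B‖ + ‖C‖) := by
    rw [radialBox_gridPoint hq0 hq1]
    calc _ ≤ _ := norm_sub_le _ _
      _ ≤ K * (‖A‖ + ‖B‖) + K * (‖B‖ + ‖C‖) := by
        rw [norm_mul, norm_mul]
        gcongr <;> exact norm_sub_le _ _
      _ = _ := by ring
  have hsq : ‖radialBox q f (gridPoint q n)‖ ^ 2
      ≤ 8 * K ^ 2 * (‖A‖ ^ 2 + ‖B‖ ^ 2 + ‖C‖ ^ 2) := by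
    calc _ ≤ (K * (‖A‖ + 2 * ‖B‖ + ‖C‖)) ^ 2 := by gcongr
      _ = K ^ 2 * (‖A‖ + 2 * ‖B‖ + ‖C‖) ^ 2 := by ring
      _ ≤ K ^ 2 * (8 * (‖A‖ ^ 2 + ‖B‖ ^ 2 + ‖C‖ ^ 2)) := by
        gcongr
        nlinarith [sq_nonneg (‖A‖ - ‖B‖), sq_nonneg (‖B‖ - ‖C‖), sq_nonneg (‖A‖ - ‖C‖),
          sq_nonneg ‖A‖, sq_nonneg ‖C‖]
      _ = _ := by ring
  have hq2 : q ^ 2 ≤ 1 := (hp 2).2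
  have t1 : q ^ 2 * gridPoint q n * ‖A‖ ^ 2 ≤ gridPoint q (n + 1) * ‖A‖ ^ 2 := by
    gcongr; nlinarith
  have t2 : q ^ 2 * gridPoint q n * ‖B‖ ^ 2 ≤ gridPoint q n * ‖B‖ ^ 2 := by
    gcongr; nlinarith
  have t3 : q ^ 2 * gridPoint q n * ‖C‖ ^ 2 ≤ gridPoint q (n - 1) * ‖C‖ ^ 2 := by
    gcongr
  have hfac : 8 / (q ^ 2 * (1 - q ^ 2) ^ 4) = 8 * K ^ 2 / q ^ 2 := by
    rw [hK]; field_simp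
  rw [hfac]
  calc _ ≤ (1 - q ^ 2) * gridPoint q n * (8 * K ^ 2 * (‖A‖ ^ 2 + ‖B‖ ^ 2 + ‖C‖ ^ 2)) := by
        gcongr
    _ = 8 * K ^ 2 / q ^ 2 * ((1 - q ^ 2) * (q ^ 2 * gridPoint q n * ‖A‖ ^ 2
          + q ^ 2 * gridPoint q n * ‖B‖ ^ 2 + q ^ 2 * gridPoint q n * ‖C‖ ^ 2)) := by
        field_simp
    _ ≤ 8 * K ^ 2 / q ^ 2 * ((1 - q ^ 2) * (gridPoint q (n + 1) * ‖A‖ ^ 2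
          + gridPoint q n * ‖B‖ ^ 2 + gridPoint q (n - 1) * ‖C‖ ^ 2)) := by
        gcongr
    _ = _ := by ring

lemma eLpNorm_radialBox_le {q : ℝ} (hq0 : 0 < q) (hq1 : q < 1) (f : ℝ → ℂ) :
    eLpNorm (radialBox q f) 2 (jacksonMeasure q)
      ≤ ENNReal.ofReal (6 / (q * (1 - q ^ 2) ^ 2)) * eLpNorm f 2 (jacksonMeasure q) := by
  have h1 : 0 < 1 - q ^ 2 := by nlinarith
  refine (ENNReal.pow_le_pow_left_iff two_ne_zero).1 ?_
  rw [mul_pow, eLpNorm_two_sq_jacksonMeasure, eLpNorm_two_sq_jacksonMeasure]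
  set u : ℕ → ℝ := fun n => (1 - q ^ 2) * gridPoint q n * ‖f (gridPoint q n)‖ ^ 2 with hu
  have hu0 : ∀ n, 0 ≤ u n := fun n => by
    have := gridPoint_pos hq0 n
    simp only [hu]; positivity
  set c : ℝ := 8 / (q ^ 2 * (1 - q ^ 2) ^ 4) with hc
  have hc0 : 0 ≤ c := by positivity
  set S := ∑' n, ENNReal.ofReal (u n) with hS
  have s1 : ∑' n, ENNReal.ofReal (u (n + 1)) ≤ S :=
    ENNReal.tsum_comp_le_tsum_of_injective (add_left_injective 1) (fun n => ENNReal.ofReal (u n))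
  have s2 : ∑' n, ENNReal.ofReal (u (n - 1)) ≤ 2 * S := by
    rw [tsum_eq_zero_add' ENNReal.summable, two_mul]
    gcongr
    · exact ENNReal.le_tsum (f := fun n => ENNReal.ofReal (u n)) 0
    · exact le_of_eq (by simp [hS])
  calc _ ≤ ∑' n, ENNReal.ofReal c * (ENNReal.ofReal (u (n + 1)) + ENNReal.ofReal (u n)
          + ENNReal.ofReal (u (n - 1))) := by
        refine ENNReal.tsum_le_tsum fun n => ?_
        rw [← ENNReal.ofReal_add (hu0 _) (hu0 _), ← ENNReal.ofReal_add (add_nonneg (hu0 _) (hu0 _))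
          (hu0 _), ← ENNReal.ofReal_mul hc0]
        exact ENNReal.ofReal_le_ofReal (radialBox_norm_sq_le hq0 hq1 f n)
    _ ≤ ENNReal.ofReal c * (S + S + 2 * S) := by
        rw [ENNReal.tsum_mul_left, ENNReal.tsum_add, ENNReal.tsum_add]
        gcongr
    _ = ENNReal.ofReal (4 * c) * S := by
        rw [ENNReal.ofReal_mul (by norm_num)]
        simp only [ENNReal.ofReal_ofNat]
        ring
    _ ≤ _ := by
        rw [← ENNReal.ofReal_pow (by positivity)]
        gcongr
        rw [hc, div_pow, mul_pow, ← pow_mul, mul_div_assoc']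
        gcongr
        norm_num

lemma memLp_radialBox {q : ℝ} (hq0 : 0 < q) (hq1 : q < 1) (f : RadialL2 q) :
    MemLp (radialBox q f) 2 (jacksonMeasure q) :=
  ⟨aestronglyMeasurable_jacksonMeasure q _,
    (eLpNorm_radialBox_le hq0 hq1 f).trans_lt
      (ENNReal.mul_lt_top ENNReal.ofReal_lt_top (Lp.eLpNorm_lt_top f))⟩

/-- The radial part `f ↦ D x (q⁻¹ x - 1) D f` of the Laplace-Beltrami operator of the quantum disc,
as a bounded operator on `RadialL2 q`. -/
def radialLaplacian (q : ℝ) (hq0 : 0 < q) (hq1 : q < 1) : RadialL2 q →L[ℂ] RadialL2 q :=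
  LinearMap.mkContinuous
    { toFun := fun f => (memLp_radialBox hq0 hq1 f).toLp (radialBox q f)
      map_add' := fun f g => by
        refine Lp.ext ?_
        have hs := (ae_jacksonMeasure hq0 hq1 _).1 (Lp.coeFn_add f g)
        filter_upwards [MemLp.coeFn_toLp (memLp_radialBox hq0 hq1 (f + g)),
          Lp.coeFn_add ((memLp_radialBox hq0 hq1 f).toLp) ((memLp_radialBox hq0 hq1 g).toLp),
          MemLp.coeFn_toLp (memLp_radialBox hq0 hq1 f),
          MemLp.coeFn_toLp (memLp_radialBox hq0 hq1 g),
          (ae_jacksonMeasure hq0 hq1 (fun x => radialBox q (f + g : RadialL2 q) x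
            = radialBox q f x + radialBox q g x)).2 fun n => by
              simp only [radialBox_gridPoint hq0 hq1, hs, Pi.add_apply]; ring]
          with x h1 h2 h3 h4 h5
        rw [h1, h2, h5, Pi.add_apply, h3, h4]
      map_smul' := fun c f => by
        refine Lp.ext ?_
        have hs := (ae_jacksonMeasure hq0 hq1 _).1 (Lp.coeFn_smul c f)
        filter_upwards [MemLp.coeFn_toLp (memLp_radialBox hq0 hq1 (c • f)),
          Lp.coeFn_smul c ((memLp_radialBox hq0 hq1 f).toLp),
          MemLp.coeFn_toLp (memLp_radialBox hq0 hq1 f),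
          (ae_jacksonMeasure hq0 hq1 (fun x => radialBox q (c • f : RadialL2 q) x
            = c * radialBox q f x)).2 fun n => by
              simp only [radialBox_gridPoint hq0 hq1, hs, Pi.smul_apply, smul_eq_mul]; ring]
          with x h1 h2 h3 h5
        rw [h1, RingHom.id_apply, h2, h5, Pi.smul_apply, h3, smul_eq_mul] }
    (6 / (q * (1 - q ^ 2) ^ 2))
    (fun f => by
      have h1 : 0 < 1 - q ^ 2 := by nlinarith
      have hk : 0 ≤ 6 / (q * (1 - q ^ 2) ^ 2) := by positivity
      rw [LinearMap.coe_mk, AddHom.coe_mk, Lp.norm_toLp, Lp.norm_def,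
        ← ENNReal.toReal_ofReal hk, ← ENNReal.toReal_mul]
      exact ENNReal.toReal_mono
        (ENNReal.mul_lt_top ENNReal.ofReal_lt_top (Lp.eLpNorm_lt_top f)).ne
        (eLpNorm_radialBox_le hq0 hq1 f))

/-- The operator acts by the difference expression. -/
lemma radialLaplacian_gridPoint {q : ℝ} (hq0 : 0 < q) (hq1 : q < 1) (f : RadialL2 q) (n : ℕ) :
    radialLaplacian q hq0 hq1 f (gridPoint q n) = radialBox q f (gridPoint q n) :=
  (ae_jacksonMeasure hq0 hq1 _).1 (MemLp.coeFn_toLp (memLp_radialBox hq0 hq1 f)) n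

end

open Filter Topology ComplexConjugate

/-! In the coordinates `q⁻ⁿ f(q⁻²ⁿ)` the space is ℓ² with a constant weight, and `(1 - q²)² □ + (1 +
q²)` becomes the Jacobi matrix with off-diagonal entries `q(1 - q²ⁿ)` and diagonal `2q²⁽ⁿ⁺¹⁾`
(`radialCoord_radialLaplacian`). It is an exponentially small perturbation of `q` times shift plus
adjoint shift, whose spectrum is `[-2q, 2q]`; the endpoints `-(1 + q²) ± 2q = -(1 ∓ q)²` become
those of the stated segment.

The perturbation does not enlarge the spectrum: `2q` plus or minus the Jacobi matrix is a sum of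
squares, up to telescoping terms (`isPositive_radialLaplacian`). This gives the operator
inequalities, and with self-adjointness one inclusion of the spectrum.

It creates no eigenvalues: the generating function `G` of a solution satisfies `(1 - 2cw + w²) G(w)
= (1 - qw)² G(q²w)`. A root `w` of the quadratic in the closed unit disc forces `G` to vanish at all
`q²ᵏw`, `k ≥ 1`, hence at `0`, and the recurrence then kills the whole sequence
(`eq_zero_of_jacobi_recurrence`).

Each point of the segment is in the spectrum: plane waves `zⁿ` with `|z| = 1`, cut off at `N`, have
squared norm proportional to `N` but residuals bounded uniformly in `N`
(`norm_sq_plane_wave_residual_le`), so no bounded inverse exists. -/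

/-! ### Coordinates: the Jacobi matrix on ℓ². -/

/-- The `n`-th coordinate of a function in `RadialL2 q`, normalised so that `RadialL2 q` becomes
a rescaled `ℓ²(ℕ)`. -/
noncomputable def radialCoord (q : ℝ) (f : RadialL2 q) (n : ℕ) : ℂ :=
  ((q⁻¹ ^ n : ℝ) : ℂ) * f (gridPoint q n)

/-- The off-diagonal entries of the Jacobi matrix of the radial Laplacian, up to the factor
`(1 - q²)⁻²`. -/
noncomputable def jacobiWeight (q : ℝ) (n : ℕ) : ℝ := q * (1 - (q ^ 2) ^ n)

lemma gridPoint_eq_sq (q : ℝ) (n : ℕ) : gridPoint q n = (q⁻¹ ^ n) ^ 2 := by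
  rw [gridPoint, ← inv_pow, ← pow_mul, ← pow_mul, mul_comm]

lemma jacobiWeight_zero (q : ℝ) : jacobiWeight q 0 = 0 := by simp [jacobiWeight]

lemma jacobiWeight_nonneg {q : ℝ} (hq0 : 0 < q) (hq1 : q < 1) (n : ℕ) : 0 ≤ jacobiWeight q n :=
  mul_nonneg hq0.le (sub_nonneg.2 (pow_le_one₀ (by positivity) (pow_le_one₀ hq0.le hq1.le)))

lemma jacobiWeight_le {q : ℝ} (hq0 : 0 < q) (n : ℕ) : jacobiWeight q n ≤ q := by
  have : 0 ≤ (q ^ 2) ^ n := by positivity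
  unfold jacobiWeight; nlinarith

lemma jacobiWeight_succ_pos {q : ℝ} (hq0 : 0 < q) (hq1 : q < 1) (n : ℕ) :
    0 < jacobiWeight q (n + 1) :=
  mul_pos hq0 (sub_pos.2 (pow_lt_one₀ (by positivity)
    (pow_lt_one₀ hq0.le hq1 two_ne_zero) n.succ_ne_zero))

lemma radialCoord_add {q : ℝ} (hq0 : 0 < q) (hq1 : q < 1) (f g : RadialL2 q) (n : ℕ) :
    radialCoord q (f + g) n = radialCoord q f n + radialCoord q g n := by
  simp only [radialCoord, (ae_jacksonMeasure hq0 hq1 _).1 (Lp.coeFn_add f g) n, Pi.add_apply]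
  ring

lemma radialCoord_smul {q : ℝ} (hq0 : 0 < q) (hq1 : q < 1) (c : ℂ) (f : RadialL2 q) (n : ℕ) :
    radialCoord q (c • f) n = c * radialCoord q f n := by
  simp only [radialCoord, (ae_jacksonMeasure hq0 hq1 _).1 (Lp.coeFn_smul c f) n, Pi.smul_apply,
    smul_eq_mul]
  ring

lemma eq_zero_of_radialCoord {q : ℝ} (hq0 : 0 < q) (hq1 : q < 1) {f : RadialL2 q}
    (h : ∀ n, radialCoord q f n = 0) : f = 0 := by
  rw [Lp.eq_zero_iff_ae_eq_zero]
  refine (ae_jacksonMeasure hq0 hq1 _).2 fun n => ?_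
  have h1 : ((q⁻¹ ^ n : ℝ) : ℂ) ≠ 0 := by
    exact_mod_cast (pow_pos (inv_pos.2 hq0) n).ne'
  exact (mul_eq_zero.1 (h n)).resolve_left h1

/-- The radial Laplacian acts on the coordinates by a Jacobi matrix. -/
lemma radialCoord_radialLaplacian {q : ℝ} (hq0 : 0 < q) (hq1 : q < 1) (f : RadialL2 q) (n : ℕ) :
    ((1 - q ^ 2) ^ 2 : ℂ) * radialCoord q (radialLaplacian q hq0 hq1 f) n
      = jacobiWeight q (n + 1) * radialCoord q f (n + 1)
        + jacobiWeight q n * radialCoord q f (n - 1)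
        - (1 + q ^ 2 - 2 * (q ^ 2) ^ (n + 1)) * radialCoord q f n := by
  have h1 : 1 - q ^ 2 ≠ 0 := by nlinarith
  have hc1 : (1 - (q : ℂ) ^ 2) ≠ 0 := by exact_mod_cast h1
  have hc2 : (q : ℂ) ≠ 0 := by exact_mod_cast hq0.ne'
  simp only [radialCoord, jacobiWeight]
  rw [radialLaplacian_gridPoint, radialBox_gridPoint hq0 hq1]
  cases n with
  | zero =>
    push_cast
    field_simp
    ring
  | succ m =>
    rw [Nat.add_sub_cancel]
    push_cast
    simp only [inv_pow]
    field_simp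
    ring

lemma hasSum_inner {q : ℝ} (hq0 : 0 < q) (hq1 : q < 1) (f g : RadialL2 q) :
    HasSum (fun n => ((1 - q ^ 2 : ℝ) : ℂ) * (conj (radialCoord q f n) * radialCoord q g n))
      (inner ℂ f g) := by
  have h1 : 0 < 1 - q ^ 2 := by nlinarith
  rw [L2.inner_def]
  have h := hasSum_integral_measure (L2.integrable_inner (𝕜 := ℂ) f g)
  refine Eq.subst (motive := fun F : ℕ → ℂ => HasSum F _) (funext fun n => ?_) h
  rw [integral_smul_measure, integral_dirac, ENNReal.toReal_ofReal
    (mul_nonneg h1.le (gridPoint_pos hq0 n).le)]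
  simp only [radialCoord, map_mul, Complex.conj_ofReal, RCLike.inner_apply, Complex.real_smul]
  have hw : ((gridPoint q n : ℝ) : ℂ) = ((q⁻¹ ^ n : ℝ) : ℂ) ^ 2 := by
    rw [gridPoint_eq_sq, Complex.ofReal_pow]
  rw [Complex.ofReal_mul, hw]
  ring

lemma hasSum_norm_sq {q : ℝ} (hq0 : 0 < q) (hq1 : q < 1) (f : RadialL2 q) :
    HasSum (fun n => (1 - q ^ 2) * ‖radialCoord q f n‖ ^ 2) (‖f‖ ^ 2) := by
  have h := (hasSum_inner hq0 hq1 f f).mapL Complex.reCLM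
  convert h using 2 with n
  · simp only [Complex.reCLM_apply, Complex.re_ofReal_mul, Complex.conj_mul']
    norm_cast
  · rw [inner_self_eq_norm_sq_to_K]
    simp [← Complex.ofReal_pow]

lemma tendsto_radialCoord {q : ℝ} (hq0 : 0 < q) (hq1 : q < 1) (f : RadialL2 q) :
    Tendsto (radialCoord q f) atTop (𝓝 0) := by
  have h1 : 1 - q ^ 2 ≠ 0 := by nlinarith
  have h := ((hasSum_norm_sq hq0 hq1 f).summable.tendsto_atTop_zero).const_mul (1 - q ^ 2)⁻¹
  simp only [← mul_assoc, inv_mul_cancel₀ h1, one_mul, mul_zero] at h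
  rw [tendsto_zero_iff_norm_tendsto_zero]
  have h2 := h.sqrt
  simpa [Real.sqrt_sq] using h2

/-- Every square summable sequence is the coordinate sequence of an element of `RadialL2 q`. -/
lemma exists_radialCoord_eq {q : ℝ} (hq0 : 0 < q) (hq1 : q < 1) (a : ℕ → ℂ)
    (ha : Summable fun n => ‖a n‖ ^ 2) : ∃ f : RadialL2 q, ∀ n, radialCoord q f n = a n := by
  have h1 : 0 < 1 - q ^ 2 := by nlinarith
  have hinj : Function.Injective (gridPoint q) :=
    (pow_right_strictMono₀ ((one_lt_inv₀ (by positivity)).2 (by linarith))).injective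
  let F : ℝ → ℂ := Function.extend (gridPoint q) (fun n => ((q ^ n : ℝ) : ℂ) * a n) 0
  have hF : ∀ n, F (gridPoint q n) = ((q ^ n : ℝ) : ℂ) * a n := fun n => hinj.extend_apply _ _ n
  have hmem : MemLp F 2 (jacksonMeasure q) := by
    refine ⟨aestronglyMeasurable_jacksonMeasure q F, ?_⟩
    have h2 : eLpNorm F 2 (jacksonMeasure q) ^ 2 < ⊤ := by
      rw [eLpNorm_two_sq_jacksonMeasure]
      have : ∀ n, (1 - q ^ 2) * gridPoint q n * ‖F (gridPoint q n)‖ ^ 2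
          = (1 - q ^ 2) * ‖a n‖ ^ 2 := fun n => by
        rw [hF, norm_mul, Complex.norm_real, Real.norm_of_nonneg (by positivity), mul_pow,
          gridPoint_eq_sq, inv_pow]
        field_simp
      simp only [this]
      exact (ha.mul_left _).tsum_ofReal_lt_top
    simpa using h2
  refine ⟨hmem.toLp F, fun n => ?_⟩
  rw [radialCoord, (ae_jacksonMeasure hq0 hq1 _).1 hmem.coeFn_toLp n, hF]
  have : (q : ℂ) ≠ 0 := by exact_mod_cast hq0.ne'
  push_cast
  rw [inv_pow]
  field_simp

/-! ### Telescoping sums and symmetry. -/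

lemma eq_zero_of_hasSum_sub {E : Type*} [AddCommGroup E] [TopologicalSpace E] [T2Space E]
    {s V : ℕ → E} {S : E} (hs : HasSum s S) (hV : Tendsto V atTop (𝓝 0)) (h0 : V 0 = 0)
    (h : ∀ n, s n = V (n + 1) - V n) : S = 0 := by
  refine tendsto_nhds_unique hs.tendsto_sum_nat (hV.congr fun N => ?_)
  rw [Finset.sum_congr rfl fun n _ => h n, Finset.sum_range_sub, h0, sub_zero]

lemma nonneg_of_hasSum_sub_le {s V : ℕ → ℝ} {S : ℝ} (hs : HasSum s S)
    (hV : Tendsto V atTop (𝓝 0)) (h0 : V 0 = 0) (h : ∀ n, V (n + 1) - V n ≤ s n) : 0 ≤ S := by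
  refine le_of_tendsto_of_tendsto' hV hs.tendsto_sum_nat fun N => ?_
  have := Finset.sum_le_sum fun n (_ : n ∈ Finset.range N) => h n
  rwa [Finset.sum_range_sub, h0, sub_zero] at this

lemma tendsto_jacobiWeight_mul {q : ℝ} (hq0 : 0 < q) (hq1 : q < 1) {u : ℕ → ℂ}
    (hu : Tendsto u atTop (𝓝 0)) : Tendsto (fun n => (jacobiWeight q n : ℂ) * u n) atTop (𝓝 0) := by
  refine squeeze_zero_norm (fun n => ?_) (by simpa using hu.norm.const_mul q)
  rw [norm_mul, Complex.norm_real, Real.norm_of_nonneg (jacobiWeight_nonneg hq0 hq1 n)]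
  exact mul_le_mul_of_nonneg_right (jacobiWeight_le hq0 n) (norm_nonneg _)

lemma tendsto_pred_atTop : Tendsto (fun n : ℕ => n - 1) atTop atTop := tendsto_sub_atTop_nat 1

/-- Summation by parts: the termwise difference of the two inner products is the increment of a
discrete Wronskian. It tends to zero because coordinates are null sequences, and starts at zero
because `jacobiWeight q 0 = 0`, which also makes the truncated index `0 - 1` harmless. -/
lemma isSymmetric_radialLaplacian {q : ℝ} (hq0 : 0 < q) (hq1 : q < 1) :
    (radialLaplacian q hq0 hq1 : RadialL2 q →ₗ[ℂ] RadialL2 q).IsSymmetric := by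
  intro f g
  have h1 : 1 - q ^ 2 ≠ 0 := by nlinarith
  have hc1 : ((1 - q ^ 2) ^ 2 : ℂ) ≠ 0 := by exact_mod_cast pow_ne_zero 2 h1
  rw [ContinuousLinearMap.coe_coe, ← sub_eq_zero]
  refine (mul_eq_zero.1 (eq_zero_of_hasSum_sub
    (V := fun n => ((1 - q ^ 2 : ℝ) : ℂ) * (jacobiWeight q n *
      (conj (radialCoord q f n) * radialCoord q g (n - 1)
        - conj (radialCoord q f (n - 1)) * radialCoord q g n)))
    (((hasSum_inner hq0 hq1 (radialLaplacian q hq0 hq1 f) g).sub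
      (hasSum_inner hq0 hq1 f (radialLaplacian q hq0 hq1 g))).mul_left ((1 - q ^ 2) ^ 2 : ℂ))
    ?_ ?_ fun n => ?_)).resolve_left hc1
  · have hf := tendsto_radialCoord hq0 hq1 f
    have hg := tendsto_radialCoord hq0 hq1 g
    have hf' := hf.comp tendsto_pred_atTop
    have hg' := hg.comp tendsto_pred_atTop
    have hcf := (Complex.continuous_conj.tendsto 0).comp hf
    have hcf' := (Complex.continuous_conj.tendsto 0).comp hf'
    have := (tendsto_jacobiWeight_mul hq0 hq1
      (by simpa using (hcf.mul hg').sub (hcf'.mul hg))).const_mul ((1 - q ^ 2 : ℝ) : ℂ)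
    simpa using this
  · simp [jacobiWeight_zero]
  · have e1 := congrArg conj (radialCoord_radialLaplacian hq0 hq1 f n)
    have e2 := radialCoord_radialLaplacian hq0 hq1 g n
    simp only [map_mul, map_sub, map_add, map_pow, map_one, Complex.conj_ofReal, map_ofNat] at e1
    rw [Nat.add_sub_cancel]
    linear_combination ((1 - q ^ 2 : ℝ) : ℂ) * radialCoord q g n * e1
      - ((1 - q ^ 2 : ℝ) : ℂ) * conj (radialCoord q f n) * e2

/-! ### Quadratic form bounds. -/

/-- One row of the form, with `c` the current coordinate and `a`, `b` its neighbours. Cross terms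
are completed to `|a + εc|²` and `|b + εc|²`; the leftover `|c|²` has nonnegative coefficient by
`hr`, and the left side is what telescopes over the rows. -/
lemma jacobi_form_lower_bound {e e' r k ε : ℝ} (he : 0 ≤ e) (he' : 0 ≤ e') (hε : ε ^ 2 = 1)
    (hr : e' + e ≤ k + 2 * ε * r) (a b c : ℂ) :
    e' * ((‖c‖ ^ 2 - ‖a‖ ^ 2) / 2) - e * ((‖b‖ ^ 2 - ‖c‖ ^ 2) / 2)
      ≤ (conj (ε * (e' * a + e * b + 2 * r * c) + k * c) * c).re := by
  have h1 := mul_nonneg he' (Complex.normSq_nonneg (a + ε * c))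
  have h2 := mul_nonneg he (Complex.normSq_nonneg (b + ε * c))
  have h3 := mul_nonneg (sub_nonneg.2 hr) (Complex.normSq_nonneg c)
  simp only [Complex.sq_norm, Complex.normSq_apply, Complex.mul_re, Complex.mul_im, Complex.add_re,
    Complex.add_im, Complex.ofReal_re, Complex.ofReal_im, Complex.conj_re, Complex.conj_im,
    Complex.re_ofNat, Complex.im_ofNat] at h1 h2 h3 ⊢
  linear_combination (1 / 2) * h1 + (1 / 2) * h2 + h3
    + (e' + e) * (c.re ^ 2 + c.im ^ 2) / 2 * hε

/-- The upper (`ε = 1`) and lower (`ε = -1`) quadratic form bounds for the negative of the radial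
Laplacian. -/
lemma isPositive_radialLaplacian {q : ℝ} (hq0 : 0 < q) (hq1 : q < 1) {ε : ℝ} (hε : ε ^ 2 = 1) :
    (ε • (radialLaplacian q hq0 hq1 + ((1 + q ^ 2) / (1 - q ^ 2) ^ 2) •
        (1 : RadialL2 q →L[ℂ] RadialL2 q))
      + (2 * q / (1 - q ^ 2) ^ 2) • (1 : RadialL2 q →L[ℂ] RadialL2 q)).IsPositive := by
  have h1 : 0 < 1 - q ^ 2 := by nlinarith
  set T := (ε • (radialLaplacian q hq0 hq1 + ((1 + q ^ 2) / (1 - q ^ 2) ^ 2) •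
        (1 : RadialL2 q →L[ℂ] RadialL2 q))
      + (2 * q / (1 - q ^ 2) ^ 2) • (1 : RadialL2 q →L[ℂ] RadialL2 q)) with hT
  have hTf : ∀ f, T f = (ε : ℂ) • (radialLaplacian q hq0 hq1 f
      + (((1 + q ^ 2) / (1 - q ^ 2) ^ 2 : ℝ) : ℂ) • f) + ((2 * q / (1 - q ^ 2) ^ 2 : ℝ) : ℂ) • f :=
    fun f => by simp only [Complex.coe_smul]; rfl
  refine ContinuousLinearMap.isPositive_def.2 ⟨fun f g => ?_, fun f => ?_⟩
  · have := isSymmetric_radialLaplacian hq0 hq1 f g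
    simp only [ContinuousLinearMap.coe_coe] at this ⊢
    simp only [hTf, inner_add_left, inner_add_right, inner_smul_left, inner_smul_right, this,
      Complex.conj_ofReal]
  · have hco : ∀ n, ((1 - q ^ 2) ^ 2 : ℂ) * radialCoord q (T f) n
        = ε * (jacobiWeight q (n + 1) * radialCoord q f (n + 1)
          + jacobiWeight q n * radialCoord q f (n - 1)
          + 2 * (q ^ 2) ^ (n + 1) * radialCoord q f n) + 2 * q * radialCoord q f n := by
      intro n
      have e := radialCoord_radialLaplacian hq0 hq1 f n
      have hc1 : (1 - (q : ℂ) ^ 2) ≠ 0 := by exact_mod_cast h1.ne'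
      rw [hTf, radialCoord_add hq0 hq1, radialCoord_smul hq0 hq1, radialCoord_add hq0 hq1,
        radialCoord_smul hq0 hq1, radialCoord_smul hq0 hq1]
      push_cast
      field_simp
      linear_combination ε * e
    -- The denominator cancels the weight of the inner product; the numerator clears the
    -- denominators of the Jacobi matrix.
    have hs := ((hasSum_inner hq0 hq1 (T f) f).mapL Complex.reCLM).mul_left
      ((1 - q ^ 2) ^ 2 / (1 - q ^ 2))
    have hf := (tendsto_radialCoord hq0 hq1 f).norm.pow 2
    have hf' := hf.comp tendsto_pred_atTop
    have key := nonneg_of_hasSum_sub_le (V := fun n => jacobiWeight q n *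
      ((‖radialCoord q f (n - 1)‖ ^ 2 - ‖radialCoord q f n‖ ^ 2) / 2)) hs ?_ ?_ fun n => ?_
    · rw [ContinuousLinearMap.reApplyInnerSelf_apply]
      exact (mul_nonneg_iff_of_pos_left (by positivity)).1 key
    · have hlim : Tendsto (fun n => (((‖radialCoord q f (n - 1)‖ ^ 2
          - ‖radialCoord q f n‖ ^ 2) / 2 : ℝ) : ℂ)) atTop (𝓝 0) := by
        have h3 : Tendsto (fun n => ((‖radialCoord q f (n - 1)‖ ^ 2
          - ‖radialCoord q f n‖ ^ 2) / 2)) atTop (𝓝 0) := by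
            simpa using (hf'.sub hf).div_const 2
        exact_mod_cast (Complex.continuous_ofReal.tendsto 0).comp h3
      have := (Complex.continuous_re.tendsto 0).comp (tendsto_jacobiWeight_mul hq0 hq1 hlim)
      refine (this.congr fun n => ?_)
      rw [Function.comp_apply, ← Complex.ofReal_mul, Complex.ofReal_re]
    · simp [jacobiWeight_zero]
    · have hp : 0 < (q ^ 2) ^ n := by positivity
      have hε1 : |ε| = 1 := by rwa [← sq_eq_sq₀ (abs_nonneg ε) zero_le_one, sq_abs, one_pow]
      -- The slack is exactly `2(ε + 1)q²⁽ⁿ⁺¹⁾ + q²ⁿ · q(1 - q)²`.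
      have hbound : jacobiWeight q (n + 1) + jacobiWeight q n
          ≤ 2 * q + 2 * ε * (q ^ 2) ^ (n + 1) := by
        have : -1 ≤ ε := hε1 ▸ neg_abs_le ε
        have h4 : 0 ≤ (ε + 1) * (q ^ 2) ^ (n + 1) := mul_nonneg (by linarith) (by positivity)
        have h5 : 0 ≤ (q ^ 2) ^ n * (q * (1 - q) ^ 2) := by positivity
        simp only [jacobiWeight, pow_succ _ n] at h4 ⊢
        nlinarith
      have h6 := jacobi_form_lower_bound (jacobiWeight_nonneg hq0 hq1 n)
        (jacobiWeight_nonneg hq0 hq1 (n + 1)) hε hbound (radialCoord q f (n + 1))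
        (radialCoord q f (n - 1)) (radialCoord q f n)
      rw [Nat.add_sub_cancel]
      refine h6.trans (le_of_eq ?_)
      have h7 := hco n
      push_cast
      rw [← h7, Complex.reCLM_apply, ← Complex.re_ofReal_mul]
      congr 1
      have hc1 : (1 - (q : ℂ) ^ 2) ≠ 0 := by exact_mod_cast h1.ne'
      simp only [map_mul, map_sub, map_pow, map_one, Complex.conj_ofReal]
      push_cast
      field_simp

/-! ### Absence of eigenvalues. -/

/-- The two roots `c ± s` have product `1`, so they cannot both lie outside the closed unit disc. -/
lemma exists_norm_le_one_root (c : ℂ) : ∃ z : ℂ, ‖z‖ ≤ 1 ∧ 1 - 2 * c * z + z ^ 2 = 0 := by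
  obtain ⟨s, hs⟩ := IsAlgClosed.exists_pow_nat_eq (c ^ 2 - 1) (n := 2) two_pos
  have h1 : (c + s) * (c - s) = 1 := by linear_combination -hs
  by_cases h : ‖c + s‖ ≤ 1
  · exact ⟨c + s, h, by linear_combination hs⟩
  · refine ⟨c - s, ?_, by linear_combination hs⟩
    have h2 := congrArg norm h1
    rw [norm_mul, norm_one] at h2
    nlinarith [norm_nonneg (c - s)]

/-- The truncated generating function of a solution of the Jacobi recurrence satisfies a
`q`-difference equation up to boundary terms. -/
lemma jacobi_generating_sum {q : ℝ} {c : ℂ} {g : ℕ → ℂ}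
    (hg : ∀ n, jacobiWeight q (n + 1) * g (n + 1) + jacobiWeight q n * g (n - 1)
      + 2 * (q ^ 2) ^ (n + 1) * g n = 2 * q * c * g n) (hq : q ≠ 0) (w : ℂ) (N : ℕ) :
    (1 - 2 * c * w + w ^ 2) * ∑ n ∈ Finset.range N, g n * w ^ n
        + (1 - (q ^ 2) ^ N) * (g N * w ^ N - g (N - 1) * w ^ (N + 1))
      = (1 - q * w) ^ 2 * ∑ n ∈ Finset.range N, g n * (q ^ 2 * w) ^ n := by
  have hc : (q : ℂ) ≠ 0 := by exact_mod_cast hq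
  induction N with
  | zero => simp
  | succ N ih =>
    rw [Finset.sum_range_succ, Finset.sum_range_succ, mul_add, mul_add _ _ (g N * _), ← ih,
      Nat.add_sub_cancel]
    have h := hg N
    simp only [jacobiWeight] at h
    push_cast at h
    rw [← mul_right_inj' hc]
    -- The recurrence carries `q` in its off-diagonal entries, hence the preceding multiplication by
    -- `q`.
    linear_combination w ^ (N + 1) * h

/-- Boundary terms vanish in the limit and `|qw| < 1` permits division by `(1 - qw)²`. The
hypothesis keeps the quadratic factor because at a root with `|w| = 1` the series itself need not
converge. -/
lemma tendsto_jacobi_generating_sum {q : ℝ} (hq0 : 0 < q) (hq1 : q < 1) {c : ℂ} {g : ℕ → ℂ}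
    (hg : ∀ n, jacobiWeight q (n + 1) * g (n + 1) + jacobiWeight q n * g (n - 1)
      + 2 * (q ^ 2) ^ (n + 1) * g n = 2 * q * c * g n) (hg0 : Tendsto g atTop (𝓝 0))
    {w : ℂ} (hw : ‖w‖ ≤ 1)
    (h : Tendsto (fun N => (1 - 2 * c * w + w ^ 2) * ∑ n ∈ Finset.range N, g n * w ^ n)
      atTop (𝓝 0)) :
    Tendsto (fun N => ∑ n ∈ Finset.range N, g n * (q ^ 2 * w) ^ n) atTop (𝓝 0) := by
  have hne : (1 - q * w) ^ 2 ≠ 0 := by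
    refine pow_ne_zero 2 (sub_ne_zero.2 fun h1 => ?_)
    have h2 := congrArg norm h1
    rw [norm_one, norm_mul, Complex.norm_real, Real.norm_of_nonneg hq0.le] at h2
    nlinarith
  have hpow : ∀ k, ‖w ^ k‖ ≤ 1 := fun k => by
    rw [norm_pow]; exact pow_le_one₀ (norm_nonneg _) hw
  have hb : Tendsto (fun N => g N * w ^ N - g (N - 1) * w ^ (N + 1)) atTop (𝓝 0) := by
    have hmul : ∀ (u : ℕ → ℂ) (k : ℕ → ℕ), Tendsto u atTop (𝓝 0) →
        Tendsto (fun N => u N * w ^ k N) atTop (𝓝 0) := fun u k hu =>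
      squeeze_zero_norm (a := fun N => ‖u N‖) (fun N => by
        rw [norm_mul]; exact mul_le_of_le_one_right (norm_nonneg _) (hpow _))
        (tendsto_zero_iff_norm_tendsto_zero.1 hu)
    simpa using (hmul g (fun N => N) hg0).sub
      (hmul _ (fun N => N + 1) (hg0.comp tendsto_pred_atTop))
  have hp : Tendsto (fun N : ℕ => 1 - ((q : ℂ) ^ 2) ^ N) atTop (𝓝 (1 - 0)) := by
    refine tendsto_const_nhds.sub (tendsto_pow_atTop_nhds_zero_of_norm_lt_one ?_)
    rw [norm_pow, Complex.norm_real, Real.norm_of_nonneg hq0.le]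
    exact pow_lt_one₀ hq0.le hq1 two_ne_zero
  have hall := (h.add (hp.mul hb)).const_mul ((1 - q * w) ^ 2)⁻¹
  simp only [mul_zero, add_zero] at hall
  refine hall.congr fun N => ?_
  rw [jacobi_generating_sum hg hq0.ne', inv_mul_cancel_left₀ hne]

/-- The identity theorem at the origin, in elementary form: the zeros `rᵏ⁺¹w` approach `0`, and
there everything beyond the constant term is `O(rᵏ⁺¹)`. -/
lemma eq_zero_of_tendsto_sum_zero {B r : ℝ} (g : ℕ → ℂ) (hB : ∀ n, ‖g n‖ ≤ B) {w : ℂ} (hr : 0 ≤ r)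
    (hr1 : r < 1) (hw : ‖w‖ ≤ 1)
    (h : ∀ k, Tendsto (fun N => ∑ n ∈ Finset.range N, g n * ((r : ℂ) ^ (k + 1) * w) ^ n)
      atTop (𝓝 0)) : g 0 = 0 := by
  have hB0 : 0 ≤ B := (norm_nonneg _).trans (hB 0)
  have hbd : ∀ k, ‖g 0‖ ≤ B * r ^ (k + 1) * (1 - r)⁻¹ := by
    intro k
    have hx : ‖(r : ℂ) ^ (k + 1) * w‖ ≤ r ^ (k + 1) := by
      rw [norm_mul, norm_pow, Complex.norm_real, Real.norm_of_nonneg hr]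
      exact mul_le_of_le_one_right (by positivity) hw
    have hrk : r ^ (k + 1) ≤ r := by
      rw [pow_succ]; exact mul_le_of_le_one_left hr (pow_le_one₀ hr hr1.le)
    set x := (r : ℂ) ^ (k + 1) * w
    have h1 := ((h k).comp (tendsto_add_atTop_nat 1)).norm
    rw [norm_zero] at h1
    have h2 : ∀ N, ‖g 0‖ - B * r ^ (k + 1) * (1 - r)⁻¹
        ≤ ‖∑ n ∈ Finset.range (N + 1), g n * x ^ n‖ := by
      intro N
      rw [Finset.sum_range_succ', pow_zero, mul_one, add_comm (Finset.sum _ _)]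
      have h3 : ‖∑ n ∈ Finset.range N, g (n + 1) * x ^ (n + 1)‖ ≤ B * r ^ (k + 1) * (1 - r)⁻¹ := by
        -- One factor of `x` keeps the small bound `rᵏ⁺¹`; the other `n` are only bounded by `r`,
        -- for a geometric series independent of `k`.
        calc _ ≤ ∑ n ∈ Finset.range N, B * r ^ (k + 1) * r ^ n := by
              refine norm_sum_le_of_le _ fun n _ => ?_
              rw [norm_mul, norm_pow, pow_succ, mul_comm (_ ^ n), ← mul_assoc]
              gcongr
              · exact hB _
              · exact hx.trans hrk
          _ ≤ _ := by
              rw [← Finset.mul_sum, ← tsum_geometric_of_lt_one hr hr1]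
              gcongr
              exact (summable_geometric_of_lt_one hr hr1).sum_le_tsum _ fun _ _ => by positivity
      have h4 := norm_sub_le_norm_add (g 0) (∑ n ∈ Finset.range N, g (n + 1) * x ^ (n + 1))
      linarith
    linarith [ge_of_tendsto' h1 h2]
  have hlim : Tendsto (fun k : ℕ => B * r ^ (k + 1) * (1 - r)⁻¹) atTop (𝓝 0) := by
    simpa using (((tendsto_pow_atTop_nhds_zero_of_lt_one hr hr1).comp
      (tendsto_add_atTop_nat 1)).const_mul B).mul_const (1 - r)⁻¹
  exact norm_le_zero_iff.1 (ge_of_tendsto' hlim hbd)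

/-- A null sequence solving the Jacobi recurrence vanishes. -/
lemma eq_zero_of_jacobi_recurrence {q : ℝ} (hq0 : 0 < q) (hq1 : q < 1) {c : ℂ} {g : ℕ → ℂ}
    (hg : ∀ n, jacobiWeight q (n + 1) * g (n + 1) + jacobiWeight q n * g (n - 1)
      + 2 * (q ^ 2) ^ (n + 1) * g n = 2 * q * c * g n) (hg0 : Tendsto g atTop (𝓝 0)) (n : ℕ) :
    g n = 0 := by
  obtain ⟨w, hw, hroot⟩ := exists_norm_le_one_root c
  have hq2 : q ^ 2 < 1 := pow_lt_one₀ hq0.le hq1 two_ne_zero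
  have hsum : ∀ k : ℕ, Tendsto (fun N => ∑ n ∈ Finset.range N,
      g n * (((q ^ 2 : ℝ) : ℂ) ^ (k + 1) * w) ^ n) atTop (𝓝 0) := by
    intro k
    push_cast
    induction k with
    | zero =>
      simpa using tendsto_jacobi_generating_sum hq0 hq1 hg hg0 hw (by simp [hroot])
    | succ k ih =>
      have hw' : ‖((q : ℂ) ^ 2) ^ (k + 1) * w‖ ≤ 1 := by
        rw [norm_mul, norm_pow, norm_pow, Complex.norm_real, Real.norm_of_nonneg hq0.le]
        exact mul_le_one₀ (pow_le_one₀ (by positivity) hq2.le) (norm_nonneg _) hw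
      have := tendsto_jacobi_generating_sum hq0 hq1 hg hg0 hw' (by simpa using ih.const_mul _)
      simpa only [pow_succ' _ (k + 1), mul_assoc] using this
  obtain ⟨B, hB⟩ := hg0.norm.bddAbove_range
  have h0 := eq_zero_of_tendsto_sum_zero g (fun n => hB ⟨n, rfl⟩) (sq_nonneg q) hq2 hw hsum
  induction n using Nat.strong_induction_on with
  | _ n ih =>
    cases n with
    | zero => exact h0
    | succ m =>
      have h := hg m
      rw [ih m (by omega), ih (m - 1) (by omega)] at h
      simp only [mul_zero, add_zero, mul_eq_zero, Complex.ofReal_eq_zero] at h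
      exact h.resolve_left (jacobiWeight_succ_pos hq0 hq1 m).ne'

lemma not_hasEigenvalue_radialLaplacian {q : ℝ} (hq0 : 0 < q) (hq1 : q < 1) (μ : ℂ) :
    ¬ Module.End.HasEigenvalue
      (radialLaplacian q hq0 hq1 : RadialL2 q →ₗ[ℂ] RadialL2 q) μ := by
  intro h
  obtain ⟨f, hf⟩ := h.exists_hasEigenvector
  have hLf : radialLaplacian q hq0 hq1 f = μ • f := hf.apply_eq_smul
  have hq : (q : ℂ) ≠ 0 := by exact_mod_cast hq0.ne'
  -- `c` is chosen so that `2qc` is the eigenvalue of the rescaled, shifted matrix.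
  refine hf.2 (eq_zero_of_radialCoord hq0 hq1 (eq_zero_of_jacobi_recurrence hq0 hq1
    (c := ((1 - q ^ 2) ^ 2 * μ + 1 + q ^ 2) / (2 * q)) (fun n => ?_)
    (tendsto_radialCoord hq0 hq1 f)))
  have e := radialCoord_radialLaplacian hq0 hq1 f n
  rw [hLf, radialCoord_smul hq0 hq1] at e
  field_simp
  linear_combination -e

/-! ### Operator inequalities and the upper bound on the spectrum. -/

lemma le_neg_radialLaplacian {q : ℝ} (hq0 : 0 < q) (hq1 : q < 1) :
    (1 / (1 + q) ^ 2 : ℝ) • (1 : RadialL2 q →L[ℂ] RadialL2 q) ≤ -radialLaplacian q hq0 hq1 := by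
  have h1 : 1 - q ≠ 0 := by linarith
  have h2 : 1 + q ≠ 0 := by linarith
  rw [ContinuousLinearMap.le_def]
  convert isPositive_radialLaplacian hq0 hq1 (ε := -1) (by norm_num) using 1
  have e : (1 / (1 + q) ^ 2 : ℝ) = (1 + q ^ 2) / (1 - q ^ 2) ^ 2 - 2 * q / (1 - q ^ 2) ^ 2 := by
    rw [show 1 - q ^ 2 = (1 - q) * (1 + q) by ring]; field_simp; ring
  rw [e]
  module

lemma neg_radialLaplacian_le {q : ℝ} (hq0 : 0 < q) (hq1 : q < 1) :
    -radialLaplacian q hq0 hq1 ≤ (1 / (1 - q) ^ 2 : ℝ) • (1 : RadialL2 q →L[ℂ] RadialL2 q) := by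
  have h1 : 1 - q ≠ 0 := by linarith
  have h2 : 1 + q ≠ 0 := by linarith
  rw [ContinuousLinearMap.le_def]
  convert isPositive_radialLaplacian hq0 hq1 (ε := 1) (by norm_num) using 1
  have e : (1 / (1 - q) ^ 2 : ℝ) = (1 + q ^ 2) / (1 - q ^ 2) ^ 2 + 2 * q / (1 - q ^ 2) ^ 2 := by
    rw [show 1 - q ^ 2 = (1 - q) * (1 + q) by ring]; field_simp; ring
  rw [e]
  module

lemma le_re_of_mem_spectrum {H : Type*} [NormedAddCommGroup H] [InnerProductSpace ℂ H]
    [CompleteSpace H] {T : H →L[ℂ] H} {m : ℝ} (hT : (T - algebraMap ℂ _ (m : ℂ)).IsPositive)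
    {z : ℂ} (hz : z ∈ spectrum ℂ T) : m ≤ z.re := by
  have hsa : IsSelfAdjoint (T - algebraMap ℂ _ (m : ℂ)) := hT.isSelfAdjoint
  have h1 : z - m ∈ spectrum ℂ (T - algebraMap ℂ _ (m : ℂ)) := by
    rw [← spectrum.sub_singleton_eq]
    exact Set.sub_mem_sub hz rfl
  have hre := hsa.mem_spectrum_eq_re h1
  rw [hre] at h1
  have h2 : (z - m).re ∈ spectrum ℝ (T - algebraMap ℂ _ (m : ℂ)) :=
    (spectrum.algebraMap_mem_iff ℂ).1 h1
  have h3 := spectrum_nonneg_of_nonneg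
    ((ContinuousLinearMap.nonneg_iff_isPositive _).2 hT) h2
  simpa using h3

lemma spectrum_radialLaplacian_subset {q : ℝ} (hq0 : 0 < q) (hq1 : q < 1) :
    spectrum ℂ (radialLaplacian q hq0 hq1)
      ⊆ (fun t : ℝ => (t : ℂ)) '' Set.Icc (-(1 / (1 - q) ^ 2)) (-(1 / (1 + q) ^ 2)) := by
  have hsa : IsSelfAdjoint (radialLaplacian q hq0 hq1) :=
    ContinuousLinearMap.isSelfAdjoint_iff_isSymmetric.2 (isSymmetric_radialLaplacian hq0 hq1)
  intro z hz
  have hz' : -z ∈ spectrum ℂ (-radialLaplacian q hq0 hq1) := by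
    rw [← spectrum.neg_eq]
    exact Set.neg_mem_neg.2 hz
  have hcast : ∀ r : ℝ, algebraMap ℂ (RadialL2 q →L[ℂ] RadialL2 q) (r : ℂ) = r • 1 := fun r => by
    rw [Algebra.algebraMap_eq_smul_one]
    ext1 f
    exact Complex.coe_smul r f
  have hl := le_re_of_mem_spectrum (m := 1 / (1 + q) ^ 2) (by
    rw [hcast]
    exact (ContinuousLinearMap.le_def _ _).1 (le_neg_radialLaplacian hq0 hq1)) hz'
  have hu := le_re_of_mem_spectrum (m := -(1 / (1 - q) ^ 2)) (by
    rw [hcast, neg_smul, sub_neg_eq_add, add_comm, ← sub_neg_eq_add]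
    exact (ContinuousLinearMap.le_def _ _).1 (neg_radialLaplacian_le hq0 hq1)) hz
  rw [Complex.neg_re] at hl
  exact ⟨z.re, ⟨hu, by linarith⟩, (hsa.mem_spectrum_eq_re hz).symm⟩

/-! ### Approximate eigenvectors. -/

/-- The residual of a truncated plane wave under the Jacobi matrix is small away from the ends. -/
lemma norm_sq_plane_wave_residual_le {q : ℝ} (hq0 : 0 < q) (hq1 : q < 1) {c : ℝ} (hc : |c| ≤ 1)
    {z : ℂ} (hz : ‖z‖ = 1) (hroot : 1 - 2 * c * z + z ^ 2 = 0) (N n : ℕ) {a : ℕ → ℂ}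
    (ha : ∀ k, a k = if k < N then z ^ k else 0) :
    ‖jacobiWeight q (n + 1) * a (n + 1) + jacobiWeight q n * a (n - 1)
      + 2 * (q ^ 2) ^ (n + 1) * a n - 2 * q * c * a n‖ ^ 2
      ≤ 36 * (q ^ 2) ^ n + ((if n = N - 1 then 36 else 0) + if n = N then 36 else 0) := by
  have hpn : (0 : ℝ) ≤ (q ^ 2) ^ n := by positivity
  have hq2 : q ^ 2 ≤ 1 := pow_le_one₀ hq0.le hq1.le
  have hpn1 : (q ^ 2) ^ n ≤ 1 := pow_le_one₀ (by positivity) hq2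
  have ha1 : ∀ k, ‖a k‖ ≤ 1 := fun k => by
    rw [ha]; split_ifs <;> simp [hz]
  have hgen : ‖jacobiWeight q (n + 1) * a (n + 1) + jacobiWeight q n * a (n - 1)
      + 2 * (q ^ 2) ^ (n + 1) * a n - 2 * q * c * a n‖ ≤ 6 := by
    have t1 : ‖(jacobiWeight q (n + 1) : ℂ) * a (n + 1)‖ ≤ 1 := by
      rw [norm_mul, Complex.norm_real, Real.norm_of_nonneg (jacobiWeight_nonneg hq0 hq1 _)]
      exact mul_le_one₀ ((jacobiWeight_le hq0 _).trans hq1.le) (norm_nonneg _) (ha1 _)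
    have t2 : ‖(jacobiWeight q n : ℂ) * a (n - 1)‖ ≤ 1 := by
      rw [norm_mul, Complex.norm_real, Real.norm_of_nonneg (jacobiWeight_nonneg hq0 hq1 _)]
      exact mul_le_one₀ ((jacobiWeight_le hq0 _).trans hq1.le) (norm_nonneg _) (ha1 _)
    have t3 : ‖2 * ((q : ℂ) ^ 2) ^ (n + 1) * a n‖ ≤ 2 := by
      rw [norm_mul, norm_mul, norm_pow, norm_pow, Complex.norm_real, Real.norm_of_nonneg hq0.le,
        RCLike.norm_ofNat, mul_assoc]
      have := mul_le_one₀ (pow_le_one₀ (n := n + 1) (by positivity) hq2) (norm_nonneg _) (ha1 n)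
      linarith
    have t4 : ‖2 * (q : ℂ) * c * a n‖ ≤ 2 := by
      rw [norm_mul, norm_mul, norm_mul, Complex.norm_real, Complex.norm_real,
        Real.norm_of_nonneg hq0.le, RCLike.norm_ofNat, mul_assoc, mul_assoc, Real.norm_eq_abs]
      have := mul_le_one₀ hq1.le (by positivity) (mul_le_one₀ hc (norm_nonneg _) (ha1 n))
      linarith
    linarith [norm_sub_le_of_le (norm_add_le_of_le (norm_add_le_of_le t1 t2) t3) t4]
  have hgen2 := pow_le_pow_left₀ (norm_nonneg _) hgen 2
  -- The crude bound `6² = 36` serves at the cut-off rows `N - 1` and `N`, and at row `0`, where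
  -- `q²ⁿ = 1`. Interior rows need the cancellation from `hroot`; rows beyond `N` vanish.
  by_cases h1 : n = N - 1
  · rw [if_pos h1]; split_ifs
    all_goals linarith
  by_cases h2 : n = N
  · rw [if_pos h2, if_neg h1]; linarith
  rw [if_neg h1, if_neg h2, add_zero, add_zero]
  rcases lt_or_gt_of_ne h2 with h3 | h3
  · cases n with
    | zero => rw [pow_zero]; linarith
    | succ m =>
      rw [Nat.add_sub_cancel, ha, ha, ha, if_pos (by omega), if_pos (by omega), if_pos h3]
      have e : (jacobiWeight q (m + 1 + 1) * z ^ (m + 1 + 1) + jacobiWeight q (m + 1) * z ^ m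
          + 2 * (q ^ 2) ^ (m + 1 + 1) * z ^ (m + 1) - 2 * q * c * z ^ (m + 1) : ℂ)
          = (q ^ 2) ^ (m + 1) * (z ^ m * (-(q * (q * z - 1) ^ 2))) := by
        simp only [jacobiWeight]
        push_cast
        linear_combination q * z ^ m * hroot
      have hz1 : ‖(q : ℂ) * z - 1‖ ≤ 2 := by
        refine (norm_sub_le _ _).trans ?_
        rw [norm_mul, hz, Complex.norm_real, Real.norm_of_nonneg hq0.le, norm_one]
        linarith
      rw [e, norm_mul, norm_mul, norm_neg, norm_mul, norm_pow z, hz, one_pow, one_mul, norm_pow,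
        norm_pow, norm_pow, Complex.norm_real, Real.norm_of_nonneg hq0.le, mul_pow]
      have h4 : q * ‖(q : ℂ) * z - 1‖ ^ 2 ≤ 1 * 2 ^ 2 := by gcongr
      have h5 : (q * ‖(q : ℂ) * z - 1‖ ^ 2) ^ 2 ≤ (1 * 2 ^ 2) ^ 2 := by gcongr
      nlinarith [mul_le_of_le_one_right hpn hpn1, sq_nonneg (q * ‖(q : ℂ) * z - 1‖ ^ 2)]
  · rw [ha, ha, ha, if_neg (by omega), if_neg (by omega), if_neg (by omega)]
    simpa using hpn

/-- If a bounded inverse `R` existed, `‖f‖ ≤ ‖R‖ ‖v‖` for the truncated waves `f` and their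
residuals `v` would bound `N`. -/
lemma subset_spectrum_radialLaplacian {q : ℝ} (hq0 : 0 < q) (hq1 : q < 1) {t : ℝ}
    (ht : t ∈ Set.Icc (-(1 / (1 - q) ^ 2)) (-(1 / (1 + q) ^ 2))) :
    (t : ℂ) ∈ spectrum ℂ (radialLaplacian q hq0 hq1) := by
  have h1 : 0 < 1 - q := by linarith
  have h2 : 0 < 1 + q := by linarith
  have h3 : 0 < 1 - q ^ 2 := by nlinarith
  have hq2 : q ^ 2 < 1 := by linarith
  set c : ℝ := ((1 - q ^ 2) ^ 2 * t + 1 + q ^ 2) / (2 * q) with hcdef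
  have hct : (1 - q ^ 2) ^ 2 * t = 2 * q * c - (1 + q ^ 2) := by
    rw [hcdef]; field_simp; ring
  have hc : |c| ≤ 1 := by
    have e1 : (1 - q ^ 2) ^ 2 * -(1 / (1 - q) ^ 2) = -(1 + q) ^ 2 := by
      rw [show 1 - q ^ 2 = (1 - q) * (1 + q) by ring]; field_simp
    have e2 : (1 - q ^ 2) ^ 2 * -(1 / (1 + q) ^ 2) = -(1 - q) ^ 2 := by
      rw [show 1 - q ^ 2 = (1 - q) * (1 + q) by ring]; field_simp
    have i1 := mul_le_mul_of_nonneg_left ht.1 (sq_nonneg (1 - q ^ 2))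
    have i2 := mul_le_mul_of_nonneg_left ht.2 (sq_nonneg (1 - q ^ 2))
    rw [e1, hct] at i1
    rw [e2, hct] at i2
    exact abs_le.2 ⟨by nlinarith, by nlinarith⟩
  have hc' := abs_le.1 hc
  obtain ⟨z, hz, hroot⟩ : ∃ z : ℂ, ‖z‖ = 1 ∧ 1 - 2 * c * z + z ^ 2 = 0 := by
    -- With `c = cos θ` the roots are `exp(±iθ)`.
    refine ⟨Complex.exp (Real.arccos c * Complex.I), Complex.norm_exp_ofReal_mul_I _, ?_⟩
    have e : (c : ℂ) = Complex.cos (Real.arccos c) := by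
      rw [← Complex.ofReal_cos, Real.cos_arccos hc'.1 hc'.2]
    have e2 := Complex.sin_sq_add_cos_sq (Real.arccos c : ℂ)
    rw [Complex.exp_mul_I, ← e]
    rw [← e] at e2
    linear_combination (Complex.sin (Real.arccos c)) ^ 2 * Complex.I_sq - e2
  rw [spectrum.mem_iff]
  rintro ⟨u, hu⟩
  set L := radialLaplacian q hq0 hq1
  set R : RadialL2 q →L[ℂ] RadialL2 q := ↑u⁻¹
  have hR : ∀ f, R ((t : ℂ) • f - L f) = f := fun f => by
    have h := congrArg (fun T : RadialL2 q →L[ℂ] RadialL2 q => T f) u.inv_mul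
    rw [hu, Algebra.algebraMap_eq_smul_one] at h
    exact h
  set C : ℝ := (36 * (1 - q ^ 2)⁻¹ + (36 + 36)) with hC
  -- `C` sums the rowwise residual bounds: a geometric series and two cut-off rows, independently of
  -- `N`.
  have hbound : ∀ N : ℕ, (N : ℝ) * (1 - q ^ 2) ^ 4 ≤ ‖R‖ ^ 2 * C := by
    intro N
    set a : ℕ → ℂ := fun k => if k < N then z ^ k else 0 with ha
    have hsum : HasSum (fun n => ‖a n‖ ^ 2) (N : ℝ) := by
      have : ∀ n ∉ Finset.range N, ‖a n‖ ^ 2 = 0 := fun n hn => by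
        simp [ha, Finset.mem_range.not.1 hn]
      have h4 := hasSum_sum_of_ne_finset_zero (L := SummationFilter.unconditional ℕ) this
      rwa [Finset.sum_congr rfl (g := fun _ => (1 : ℝ)) fun n hn => by
        simp [ha, Finset.mem_range.1 hn, hz], Finset.sum_const, Finset.card_range,
        nsmul_one] at h4
    obtain ⟨f, hf⟩ := exists_radialCoord_eq hq0 hq1 a hsum.summable
    have hnf : ‖f‖ ^ 2 = (1 - q ^ 2) * N := by
      refine (hasSum_norm_sq hq0 hq1 f).unique ?_
      simp only [hf]
      exact hsum.mul_left _
    set v := (t : ℂ) • f - L f with hv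
    have hcoord : ∀ n, ((1 - q ^ 2) ^ 2 : ℂ) * radialCoord q v n
        = -(jacobiWeight q (n + 1) * a (n + 1) + jacobiWeight q n * a (n - 1)
          + 2 * (q ^ 2) ^ (n + 1) * a n - 2 * q * c * a n) := by
      intro n
      have e := radialCoord_radialLaplacian hq0 hq1 f n
      have hct' : (1 - (q : ℂ) ^ 2) ^ 2 * t = 2 * q * c - (1 + q ^ 2) := by exact_mod_cast hct
      rw [show v = (t : ℂ) • f + (-1 : ℂ) • L f by rw [hv]; module,
        radialCoord_add hq0 hq1, radialCoord_smul hq0 hq1, radialCoord_smul hq0 hq1]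
      simp only [hf] at e ⊢
      linear_combination -e + a n * hct'
    have hnv : (1 - q ^ 2) ^ 3 * ‖v‖ ^ 2 ≤ C := by
      have hs := (hasSum_norm_sq hq0 hq1 v).mul_left ((1 - q ^ 2) ^ 3)
      have hCs : HasSum (fun n => 36 * (q ^ 2) ^ n
          + ((if n = N - 1 then (36 : ℝ) else 0) + if n = N then 36 else 0)) C := by
        refine ((hasSum_geometric_of_lt_one (sq_nonneg q) hq2).mul_left 36).add (HasSum.add ?_ ?_)
        · exact hasSum_ite_eq (N - 1) 36
        · exact hasSum_ite_eq N 36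
      refine hasSum_le (fun n => ?_) hs hCs
      refine le_trans (le_of_eq ?_)
        (norm_sq_plane_wave_residual_le hq0 hq1 hc hz hroot N n (a := a) fun _ => rfl)
      have h4 : ‖((1 - (q : ℂ) ^ 2) ^ 2)‖ = (1 - q ^ 2) ^ 2 := by
        rw [← Complex.ofReal_pow, ← Complex.ofReal_one, ← Complex.ofReal_sub, norm_pow,
          Complex.norm_real, Real.norm_of_nonneg h3.le]
      rw [← norm_neg (_ - _), ← hcoord, norm_mul, mul_pow, h4]
      ring
    have hfv : ‖f‖ ≤ ‖R‖ * ‖v‖ := by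
      calc ‖f‖ = ‖R v‖ := by rw [hR]
        _ ≤ _ := R.le_opNorm v
    calc (N : ℝ) * (1 - q ^ 2) ^ 4 = (1 - q ^ 2) ^ 3 * ‖f‖ ^ 2 := by rw [hnf]; ring
      _ ≤ (1 - q ^ 2) ^ 3 * (‖R‖ * ‖v‖) ^ 2 := by gcongr
      _ = ‖R‖ ^ 2 * ((1 - q ^ 2) ^ 3 * ‖v‖ ^ 2) := by ring
      _ ≤ _ := by gcongr
  obtain ⟨N, hN⟩ := exists_nat_gt (‖R‖ ^ 2 * C / (1 - q ^ 2) ^ 4)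
  rw [div_lt_iff₀ (by positivity)] at hN
  exact absurd (hbound N) (not_le.2 hN)

theorem corollary4p2 (q : ℝ) (hq0 : 0 < q) (hq1 : q < 1) :
    spectrum ℂ (radialLaplacian q hq0 hq1)
        = (fun t : ℝ => (t : ℂ)) '' Set.Icc (-(1 / (1 - q) ^ 2)) (-(1 / (1 + q) ^ 2)) ∧
      (∀ μ : ℂ, ¬ Module.End.HasEigenvalue
        (radialLaplacian q hq0 hq1 : RadialL2 q →ₗ[ℂ] RadialL2 q) μ) ∧
      (1 / (1 + q) ^ 2 : ℝ) • (1 : RadialL2 q →L[ℂ] RadialL2 q) ≤ -radialLaplacian q hq0 hq1 ∧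
      -radialLaplacian q hq0 hq1 ≤ (1 / (1 - q) ^ 2 : ℝ) • (1 : RadialL2 q →L[ℂ] RadialL2 q) := by
  refine ⟨(spectrum_radialLaplacian_subset hq0 hq1).antisymm ?_,
    not_hasEigenvalue_radialLaplacian hq0 hq1, le_neg_radialLaplacian hq0 hq1,
    neg_radialLaplacian_le hq0 hq1⟩
  rintro _ ⟨t, ht, rfl⟩
  exact subset_spectrum_radialLaplacian hq0 hq1 ht
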